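/- Let $m,n>1$, $V=V_1\oplus\dots\oplus V_n$ with each $V_i=(\mathbb F_2)^m$, and write maps on the right. A *bricklayer transformation* is a permutation $\gamma$ of $V$ of the form $(v_1+\dots+v_n)\gamma=v_1\gamma_1+\dots+v_n\gamma_n$ with $v_i\in V_i$ and *bricks* $\gamma_i\in\mathrm{Sym}(V_i)$. A *wall* is a nontrivial proper subspace of $V$ that is a sum of some of the $V_i$. A map $\lambda\in\mathrm{GL}(V)$ is *proper* if no wall is $\lambda$-invariant, and *strongly proper* if there are no walls $W,W'$ with $W\lambda=W'$. A *translation based (tb) cipher* $\mathcal C$ over $V$ with key space $\mathcal K$ and $l$ rounds is given by round functions $\tau_{k,h}=\gamma_h\lambda_h\sigma_{\phi(k,h)}$ ($k\in\mathcal K$, $1\le h\le l$), where $\gamma_h$ is a bricklayer transformation with $0\gamma_h=0$, $\lambda_h\in\mathrm{GL}(V)$, $\phi:\mathcal K\times\{1,\dots,l\}\to V$ and $\sigma_v:x\mapsto x+v$, such that at least one round $h$ is *proper*, that is, $\lambda_h$ is proper and $k\mapsto\phi(k,h)$ is surjective onto $V$. A proper round $h$ is *strongly proper* if $\lambda_h$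 is strongly proper. Put $\Gamma_h(\mathcal C)=\langle\tau_{k,h}\mid k\in\mathcal K\rangle\le\mathrm{Sym}(V)$. For $f:(\mathbb F_2)^m\to(\mathbb F_2)^m$ and $u\in(\mathbb F_2)^m$ let $\hat f_u(x)=f(x+u)+f(x)$. The map $f$ is *$\delta$-uniform* if $|\{x:\hat f_u(x)=v\}|\le\delta$ for all $u\neq0$ and all $v$; it is *weakly $\delta$-uniform* if $|\mathrm{Im}\,\hat f_u|>2^{m-1}/\delta$ for all $u\ne0$; it is *strongly $r$-anti-invariant* if, for any subspaces $U,W$ of $(\mathbb F_2)^m$ with $f(U)=W$, either $\dim U=\dim W<m-r$ or $U=W=(\mathbb F_2)^m$. A permutation group $G$ of degree $2^d$ is called a *wreath product* (in the product action) if $G=(S_1\times\dots\times S_c).O.P$ and $G$ has an elementary abelian regular subgroup $T=T_1\times\dots\times T_c$, where $c>1$ divides $d$, each $T_i$ is an abelian subgroup of $S_i$ of order $2^{d/c}$, each $S_i$ is isomorphic to $\mathrm{Alt}(2^{d/c})$ or $\mathrm{Sym}(2^{d/c})$, the $S_i$ are all conjugate in $G$, $O\le\mathrm{Out}(S_1)\times\dots\times\mathrm{Out}(S_c)$,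 and $P$ permutes the $S_i$ transitively. In detail: $N=S_1\times\dots\times S_c$ is an internal direct product of subgroups of $G$ and is normal in $G$; there is a normal subgroup $M$ of $G$, with $N\le M$, that normalizes every $S_i$ and for which the kernel of $M\to\mathrm{Out}(S_1)\times\dots\times\mathrm{Out}(S_c)$ given by conjugation is $N$ (so $O=M/N$ and $P=G/M$); and $G$ permutes $S_1,\dots,S_c$ transitively by conjugation. **Proposition.** Let $\mathcal C$ be a tb cipher with a strongly proper round $h$. Suppose that either (a) for some $1<r<m$, each brick of $\gamma_h$ is $2^r$-uniform and strongly $(r-1)$-anti-invariant; or (b) for some $1\le r<m$, each brick of $\gamma_h$ is weakly $2^r$-uniform and strongly $r$-anti-invariant. Then $\Gamma_h(\mathcal C)$ is primitive and is not a wreath product. -/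

import Mathlib

namespace TBC

/-- The space `(𝔽₂)^m` on which an `m`-bit S-box acts. -/
abbrev Brick (m : ℕ) : Type := Fin m → ZMod 2

/-- The message space `V = V₁ ⊕ ⋯ ⊕ Vₙ`, where every `Vᵢ` is a copy of `(𝔽₂)^m`. -/
abbrev Msg (m n : ℕ) : Type := Fin n → Brick m

/-- The summand `Vᵢ` of `V`, as a subspace of `V`. -/
def brickSpace (m n : ℕ) (i : Fin n) : Submodule (ZMod 2) (Msg m n) :=
  LinearMap.range (LinearMap.single (ZMod 2) (fun _ : Fin n => Brick m) i)

/-- The bricklayer transformation `v₁ + ⋯ + vₙ ↦ v₁γ₁ + ⋯ + vₙγₙ` with bricks `γᵢ`. -/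
def bricklayer {m n : ℕ} (g : Fin n → Equiv.Perm (Brick m)) : Equiv.Perm (Msg m n) :=
  Equiv.piCongrRight g

/-- A wall: a nontrivial proper subspace of `V` that is a sum of some of the `Vᵢ`. -/
def IsWall {m n : ℕ} (W : Submodule (ZMod 2) (Msg m n)) : Prop :=
  W ≠ ⊥ ∧ W ≠ ⊤ ∧ ∃ I : Set (Fin n), W = ⨆ i ∈ I, brickSpace m n i

/-- A proper mixing layer: no wall is invariant. -/
def IsProperMixing {m n : ℕ} (lam : Msg m n ≃ₗ[ZMod 2] Msg m n) : Prop :=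
  ∀ W : Submodule (ZMod 2) (Msg m n), IsWall W → ¬ W.map lam.toLinearMap ≤ W

/-- A strongly proper mixing layer: no wall is mapped onto a wall. -/
def IsStronglyProperMixing {m n : ℕ} (lam : Msg m n ≃ₗ[ZMod 2] Msg m n) : Prop :=
  ∀ W W' : Submodule (ZMod 2) (Msg m n), IsWall W → IsWall W' → W.map lam.toLinearMap ≠ W'

/-- A translation based cipher with `l` rounds and key space `K`: the round function
`τ_{k,h}` is `γ_h`, followed by `λ_h`, followed by the translation by the round key `φ(k,h)`.
At least one round is proper. -/
structure TBCipher (m n l : ℕ) (K : Type*) where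
  /-- the bricks of `γ_h` -/
  brick : Fin l → Fin n → Equiv.Perm (Brick m)
  /-- `0 γ_h = 0` -/
  bricklayer_zero : ∀ h, bricklayer (brick h) 0 = 0
  /-- `λ_h` -/
  mixing : Fin l → (Msg m n ≃ₗ[ZMod 2] Msg m n)
  /-- the key scheduling function `φ` -/
  keySchedule : K → Fin l → Msg m n
  exists_proper_round :
    ∃ h, IsProperMixing (mixing h) ∧ Function.Surjective (fun k => keySchedule k h)

namespace TBCipher

variable {m n l : ℕ} {K : Type*}

/-- The `h`-th round function `τ_{k,h} = γ_h λ_h σ_{φ(k,h)}` (maps are composed from left to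
right): `v ↦ λ_h (γ_h v) + φ(k,h)`. -/
def roundFunction (C : TBCipher m n l K) (k : K) (h : Fin l) : Equiv.Perm (Msg m n) :=
  ((bricklayer (C.brick h)).trans (C.mixing h).toEquiv).trans (Equiv.addRight (C.keySchedule k h))

/-- The group `Γ_h(C)` generated by the `h`-th round functions. -/
def roundGroup (C : TBCipher m n l K) (h : Fin l) : Subgroup (Equiv.Perm (Msg m n)) :=
  Subgroup.closure (Set.range fun k => C.roundFunction k h)

/-- A proper round. -/
def IsProperRound (C : TBCipher m n l K) (h : Fin l) : Prop :=
  IsProperMixing (C.mixing h) ∧ Function.Surjective (fun k => C.keySchedule k h)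

/-- A strongly proper round: a proper round whose mixing layer is strongly proper. -/
def IsStronglyProperRound (C : TBCipher m n l K) (h : Fin l) : Prop :=
  C.IsProperRound h ∧ IsStronglyProperMixing (C.mixing h)

end TBCipher

/-- The derivative of `f` in the direction `u`. -/
def derivative {m : ℕ} (f : Brick m → Brick m) (u x : Brick m) : Brick m :=
  f (x + u) + f x

/-- `f` is (differentially) `δ`-uniform. -/
def IsUniform {m : ℕ} (δ : ℕ) (f : Brick m → Brick m) : Prop :=
  ∀ u v : Brick m, u ≠ 0 → {x : Brick m | derivative f u x = v}.ncard ≤ δ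

/-- `f` is weakly `δ`-uniform: the image of each derivative in a nonzero direction has more
than `2^(m-1) / δ` elements (for positive `m` and `δ`; the denominator is cleared). -/
def IsWeaklyUniform {m : ℕ} (δ : ℕ) (f : Brick m → Brick m) : Prop :=
  ∀ u : Brick m, u ≠ 0 → 2 ^ (m - 1) < δ * (Set.range (derivative f u)).ncard

/-- `f` is strongly `r`-anti-invariant: if `f(U) = W` for subspaces `U`, `W`, then either
`dim U = dim W < m - r` or `U = W` is the whole space. -/
def IsStronglyAntiInvariant {m : ℕ} (r : ℕ) (f : Brick m → Brick m) : Prop :=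
  ∀ U W : Submodule (ZMod 2) (Brick m), f '' (U : Set (Brick m)) = W →
    (Module.finrank (ZMod 2) U = Module.finrank (ZMod 2) W ∧
      Module.finrank (ZMod 2) W + r < m) ∨ (U = ⊤ ∧ W = ⊤)

/-- A permutation group of degree `2^d` on `X` that is a wreath product (in the product action):
`G = (S₁ × ⋯ × S_c).O.P`, where `c > 1` divides `d = c * e`, and `T = T₁ × ⋯ × T_c` is an
elementary abelian regular subgroup with `Tᵢ ≤ Sᵢ`.
Here `N = ⨆ i, S i` is the internal direct product of the `Sᵢ`, `O = M / N` and `P = G / M`. -/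
def IsWreathProduct {X : Type*} (G : Subgroup (Equiv.Perm X)) : Prop :=
  ∃ (c e : ℕ) (S T : Fin c → Subgroup (Equiv.Perm X)) (M : Subgroup (Equiv.Perm X)),
    1 < c ∧ Nat.card X = 2 ^ (c * e) ∧
    -- the product of the `Sᵢ` is direct
    (∀ i j, i ≠ j → ∀ x ∈ S i, ∀ y ∈ S j, x * y = y * x) ∧ iSupIndep S ∧
    -- each `Sᵢ` is isomorphic to the alternating or the symmetric group of degree `2^(d/c)`
    (∀ i, Nonempty (S i ≃* alternatingGroup (Fin (2 ^ e))) ∨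
      Nonempty (S i ≃* Equiv.Perm (Fin (2 ^ e)))) ∧
    -- each `Tᵢ` is an abelian subgroup of `Sᵢ` of order `2^(d/c)`
    (∀ i, T i ≤ S i ∧ (∀ x ∈ T i, ∀ y ∈ T i, x * y = y * x) ∧ Nat.card (T i) = 2 ^ e) ∧
    -- their product `T` is an elementary abelian group which is regular on `X`
    (∀ t ∈ ⨆ i, T i, t ^ 2 = 1) ∧ (∀ x y : X, ∃! t, t ∈ (⨆ i, T i) ∧ t x = y) ∧
    -- `N ≤ M ≤ G`, and both `N` and `M` are normal in `G`
    (⨆ i, S i) ≤ M ∧ M ≤ G ∧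
    (∀ g ∈ G, ∀ x ∈ ⨆ i, S i, g * x * g⁻¹ ∈ ⨆ i, S i) ∧
    (∀ g ∈ G, ∀ x ∈ M, g * x * g⁻¹ ∈ M) ∧
    -- `M` normalizes every `Sᵢ`, and the kernel of `M → Out(S₁) × ⋯ × Out(S_c)` is `N`,
    -- so that `M / N` is a subgroup of `Out(S₁) × ⋯ × Out(S_c)`
    (∀ g ∈ M, ∀ i, (S i).map (MulAut.conj g).toMonoidHom = S i) ∧
    (∀ g ∈ M, (∀ i, ∃ s ∈ S i, ∀ x ∈ S i, g * x * g⁻¹ = s * x * s⁻¹) → g ∈ ⨆ i, S i) ∧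
    -- `G`, hence `P = G / M`, permutes the `Sᵢ` transitively by conjugation
    (∀ g ∈ G, ∀ i, ∃ j, (S i).map (MulAut.conj g).toMonoidHom = S j) ∧
    (∀ i j, ∃ g ∈ G, (S i).map (MulAut.conj g).toMonoidHom = S j)

end TBC

/-!
Let `ρ = γ_h λ_h`. Since the round keys exhaust `V`, the group `Γ_h` contains `ρ` and all
translations. Both claims reduce to one fact about bricklayer transformations
(`isWall_of_cosets`): if `γ` maps the cosets of a proper nontrivial subspace `U` onto the cosets of
a subspace `W`, then `U` is a wall and `W = U`. Indeed, if `u ∈ U` has `u i ≠ 0`, then `W ∩ Vᵢ`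
contains the differences of values of the derivative of `γᵢ` in the direction `u i`. By
(weak) uniformity it is too large for the anti-invariance of `γᵢ`, which maps `U ∩ Vᵢ` onto
`W ∩ Vᵢ`, unless both are all of `Vᵢ` (`AbsorbsDerivatives`).

A block of `Γ_h` containing `0` is a subspace `U` whose cosets are permuted by `ρ`, so that `γ` maps
the cosets of `U` onto those of `W = U λ⁻¹`. If `U` is nontrivial and proper, it is therefore a wall
with `U λ = U`, which a proper mixing layer excludes. This gives primitivity.

Suppose now that `Γ_h` is a wreath product with factors `S i`. Say that two points have the same
`i`-th coordinate if they lie in one orbit of the product of the factors `S j`, `j ≠ i`. The group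
permutes these equivalence relations, and coordinates can be prescribed independently, because the
product of all factors is transitive. No relation holds everywhere: otherwise `S i` commutes
with a transitive group and hence is semiregular, but for `e ≥ 2` its order is divisible by `3`, while
the degree is a power of `2`; for `e = 1` the factors `S j` and `T j` coincide, and the product of
all the `T j` is regular (`IsWreathProduct.exists_coordinates`).
The given regular subgroup need not consist of translations. Nevertheless, every
translation preserves each coordinate (`IsPermutedCoordinates.add_right_iff`), so the classes of the
`i`-th coordinate are the cosets of a subspace. The map `ρ` permutes these subspaces. By the fact
above they are walls and `γ` fixes them, so `λ` maps a wall to a wall, which contradicts strong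
properness.
-/

namespace TBC

/-! ### Bricks and their derivatives -/

/-- The common consequence of both pairs of conditions on a brick. If `f` maps a subspace `A` onto a
subspace `W`, if `W` contains the values of all derivatives of `f` in directions of `A`, and if `W`
contains all differences of values of some derivative of `f` in a nonzero direction, then `A` and
`W` are the whole space. -/
def AbsorbsDerivatives {m : ℕ} (f : Brick m → Brick m) : Prop :=
  ∀ (A W : Submodule (ZMod 2) (Brick m)) (u : Brick m), u ≠ 0 → f '' (A : Set (Brick m)) = W →
    (∀ a ∈ A, ∀ x, derivative f a x ∈ W) → (∀ x y, derivative f u x + derivative f u y ∈ W) →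
    A = ⊤ ∧ W = ⊤

lemma card_submodule {m : ℕ} (W : Submodule (ZMod 2) (Brick m)) :
    (W : Set (Brick m)).ncard = 2 ^ Module.finrank (ZMod 2) W := by
  have h := Module.natCard_eq_pow_finrank (K := ZMod 2) (V := W)
  rw [Nat.card_zmod] at h
  rw [← h]
  rfl

lemma ncard_range_derivative_le {m : ℕ} {f : Brick m → Brick m}
    {W : Submodule (ZMod 2) (Brick m)} {u : Brick m}
    (hW : ∀ x y, derivative f u x + derivative f u y ∈ W) :
    (Set.range (derivative f u)).ncard ≤ 2 ^ Module.finrank (ZMod 2) W := by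
  rw [← card_submodule W]
  refine Set.ncard_le_ncard_of_injOn (· + derivative f u 0) ?_ ?_ (Set.toFinite _)
  · rintro _ ⟨x, rfl⟩
    exact hW x 0
  · intro a _ b _ hab
    exact add_right_cancel hab

lemma IsWeaklyUniform.absorbsDerivatives {m r : ℕ} {f : Brick m → Brick m}
    (hf : IsWeaklyUniform (2 ^ r) f) (hs : IsStronglyAntiInvariant r f) :
    AbsorbsDerivatives f := by
  intro A W u hu hAW hdir hW
  refine (hs A W hAW).resolve_left fun ⟨_, hlt⟩ => ?_
  have h1 := (hf u hu).trans_le (Nat.mul_le_mul_left _ (ncard_range_derivative_le hW))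
  rw [← pow_add] at h1
  have h2 := (Nat.pow_lt_pow_iff_right (by norm_num : 1 < 2)).1 h1
  omega

lemma IsUniform.two_pow_le {m δ : ℕ} {f : Brick m → Brick m} (hf : IsUniform δ f)
    {u : Brick m} (hu : u ≠ 0) : 2 ^ m ≤ δ * (Set.range (derivative f u)).ncard := by
  classical
  have h := Finset.card_le_mul_card_image (f := derivative f u) Finset.univ δ (fun b _ => by
    have := hf u b hu
    rwa [Set.ncard_eq_toFinset_card', Set.toFinset_ofPred] at this)
  rw [← Set.image_univ, ← Finset.coe_univ, ← Finset.coe_image, Set.ncard_coe_finset]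
  simpa [ZMod.card] using h

/-- Uniformity alone gives `W` dimension at least `m - r`. The missing dimension is gained by
taking the derivative in a direction that lies in `A`: its values lie in `W` and are nonzero,
because `f` is injective. -/
lemma IsUniform.absorbsDerivatives {m r : ℕ} (hr : 1 < r) (hrm : r < m) {f : Equiv.Perm (Brick m)}
    (hf : IsUniform (2 ^ r) f) (hs : IsStronglyAntiInvariant (r - 1) f) :
    AbsorbsDerivatives f := by
  intro A W u hu hAW hdir hW
  refine (hs A W hAW).resolve_left fun ⟨hdim, hlt⟩ => ?_
  have h1 := (hf.two_pow_le hu).trans (Nat.mul_le_mul_left _ (ncard_range_derivative_le hW))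
  rw [← pow_add] at h1
  have h2 := (Nat.pow_le_pow_iff_right (by norm_num : 1 < 2)).1 h1
  have hA : A ≠ ⊥ := by
    rintro rfl
    rw [finrank_bot] at hdim
    omega
  obtain ⟨a, haA, ha⟩ := A.ne_bot_iff.1 hA
  have h3 : (Set.range (derivative f a)).ncard < 2 ^ Module.finrank (ZMod 2) W := by
    rw [← card_submodule W]
    refine Set.ncard_lt_ncard ⟨?_, fun hle => ?_⟩ (Set.toFinite _)
    · rintro _ ⟨x, rfl⟩
      exact hdir a haA x
    · obtain ⟨x, hx⟩ := hle W.zero_mem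
      rw [derivative, ← ZModModule.sub_eq_add, sub_eq_zero] at hx
      exact ha (by simpa using f.injective hx)
  have h4 := (hf.two_pow_le ha).trans_lt (Nat.mul_lt_mul_of_pos_left h3 (by positivity))
  rw [← pow_add] at h4
  have h5 := (Nat.pow_lt_pow_iff_right (by norm_num : 1 < 2)).1 h4
  omega

/-! ### Bricklayer transformations that permute the cosets of subspaces -/

variable {m n : ℕ}

lemma mem_brickSpace_le {U : Submodule (ZMod 2) (Msg m n)} {i : Fin n} :
    brickSpace m n i ≤ U ↔ ∀ x : Brick m, Pi.single i x ∈ U := by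
  rw [brickSpace, LinearMap.range_eq_map, Submodule.map_le_iff_le_comap]
  simp [SetLike.le_def]

/-- If `f = bricklayer g` maps the cosets of `U` onto the cosets of `W`, then both contain every
summand of `V` onto which `U` projects nontrivially. For `u` in `U` and `x`
in `Vᵢ`, the coordinates of `(u + x)γ + xγ` other than the `i`-th do not depend on `x`, so that
differences of values of the derivative of the `i`-th brick in the direction `u i` lie in
`W ∩ Vᵢ`. -/
lemma brickSpace_le_of_cosets {g : Fin n → Equiv.Perm (Brick m)} (h0 : bricklayer g 0 = 0)
    (hg : ∀ i, AbsorbsDerivatives (g i)) {U W : Submodule (ZMod 2) (Msg m n)}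
    (hUW : ∀ x y, x + y ∈ U ↔ bricklayer g x + bricklayer g y ∈ W)
    {u : Msg m n} (hu : u ∈ U) {i : Fin n} (hi : u i ≠ 0) :
    brickSpace m n i ≤ U ∧ brickSpace m n i ≤ W := by
  have hg0 : ∀ j, g j 0 = 0 := fun j => congrFun h0 j
  have hsingle : ∀ x : Brick m, bricklayer g (Pi.single i x) = Pi.single i (g i x) := by
    intro x
    funext j
    rcases eq_or_ne j i with rfl | hj
    · simp [bricklayer]
    · simp [bricklayer, hj, hg0]
  have key := hg i (U.comap (LinearMap.single (ZMod 2) (fun _ => Brick m) i))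
    (W.comap (LinearMap.single (ZMod 2) (fun _ => Brick m) i)) (u i) hi ?_ ?_ ?_
  · rw [mem_brickSpace_le, mem_brickSpace_le]
    exact ⟨fun x => (key.1.ge (Submodule.mem_top (x := x)) :), fun x =>
      (key.2.ge (Submodule.mem_top (x := x)) :)⟩
  · have hmem : ∀ x : Brick m, Pi.single i x ∈ U ↔ (Pi.single i (g i x) : Msg m n) ∈ W := by
      intro x
      have := hUW (Pi.single i x) 0
      rwa [h0, add_zero, add_zero, hsingle] at this
    ext y
    obtain ⟨x, rfl⟩ := (g i).surjective y
    simp [hmem]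
  · intro a ha x
    have := (hUW (Pi.single i (x + a)) (Pi.single i x)).1 (by
      rwa [← Pi.single_add, add_right_comm, ZModModule.add_self, zero_add])
    rwa [hsingle, hsingle, ← Pi.single_add] at this
  · intro x y
    have hd : ∀ x : Brick m, bricklayer g (u + Pi.single i x) +
        bricklayer g (Pi.single i x) ∈ W := fun x => (hUW _ _).1 (by
      rwa [add_assoc, ZModModule.add_self, add_zero])
    have := W.add_mem (hd x) (hd y)
    rw [hsingle, hsingle] at this
    show (Pi.single i _ : Msg m n) ∈ W
    convert this using 1
    funext j
    rcases eq_or_ne j i with rfl | hj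
    · simp [bricklayer, derivative, add_comm (u j)]
    · simp [bricklayer, hj, ZModModule.add_self]

lemma mem_of_brickSpace_le {U : Submodule (ZMod 2) (Msg m n)} {u : Msg m n}
    (h : ∀ i, u i ≠ 0 → brickSpace m n i ≤ U) : u ∈ U := by
  rw [← Finset.univ_sum_single u]
  refine U.sum_mem fun i _ => ?_
  by_cases hi : u i = 0
  · rw [hi, Pi.single_zero]
    exact U.zero_mem
  · exact mem_brickSpace_le.1 (h i hi) _

/-- A proper nontrivial subspace whose cosets are mapped by a bricklayer transformation onto the
cosets of some subspace `W` is a wall, and `W` is the same wall. -/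
lemma isWall_of_cosets {g : Fin n → Equiv.Perm (Brick m)} (h0 : bricklayer g 0 = 0)
    (hg : ∀ i, AbsorbsDerivatives (g i)) {U W : Submodule (ZMod 2) (Msg m n)}
    (hUW : ∀ x y, x + y ∈ U ↔ bricklayer g x + bricklayer g y ∈ W)
    (hbot : U ≠ ⊥) (htop : U ≠ ⊤) : IsWall U ∧ W = U := by
  have key := fun u (hu : u ∈ U) i hi => brickSpace_le_of_cosets h0 hg hUW hu (i := i) hi
  refine ⟨⟨hbot, htop, {i | brickSpace m n i ≤ U}, le_antisymm (fun u hu => ?_)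
    (iSup₂_le fun i hi => hi)⟩, le_antisymm (fun w hw => ?_) fun u hu => ?_⟩
  · exact mem_of_brickSpace_le fun i hi =>
      le_iSup₂_of_le (f := fun i (_ : i ∈ {i | brickSpace m n i ≤ U}) => brickSpace m n i)
        i (key u hu i hi).1 le_rfl
  · obtain ⟨u, rfl⟩ := (bricklayer g).surjective w
    have hu : u ∈ U := by
      have := hUW u 0
      rwa [h0, add_zero, add_zero, iff_true_right hw] at this
    refine mem_of_brickSpace_le fun i hi => (key u hu i fun hui => hi ?_).1
    have : g i 0 = 0 := congrFun h0 i
    simp [bricklayer, hui, this]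
  · exact mem_of_brickSpace_le fun i hi => (key u hu i hi).2
/-! ### The product structure of a wreath product -/

section ProductAction

variable {X : Type*} {ι : Type*} {S : ι → Subgroup (Equiv.Perm X)}

/-- The product of all the factors except the `i`-th. -/
def complementFactor (S : ι → Subgroup (Equiv.Perm X)) (i : ι) : Subgroup (Equiv.Perm X) :=
  ⨆ (j : ι) (_ : j ≠ i), S j

/-- Two points agree in the `i`-th coordinate if the factors other than the `i`-th can move one
to the other. -/
def SameCoord (S : ι → Subgroup (Equiv.Perm X)) (i : ι) (x y : X) : Prop :=
  ∃ g ∈ complementFactor S i, g x = y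

lemma le_complementFactor {i j : ι} (h : j ≠ i) : S j ≤ complementFactor S i :=
  le_iSup₂_of_le (f := fun j (_ : j ≠ i) => S j) j h le_rfl

lemma SameCoord.refl (i : ι) (x : X) : SameCoord S i x x :=
  ⟨1, one_mem _, rfl⟩

lemma SameCoord.symm {i : ι} {x y : X} (h : SameCoord S i x y) : SameCoord S i y x := by
  obtain ⟨g, hg, rfl⟩ := h
  exact ⟨g⁻¹, inv_mem hg, by simp⟩

lemma SameCoord.trans {i : ι} {x y z : X} (h : SameCoord S i x y) (h' : SameCoord S i y z) :
    SameCoord S i x z := by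
  obtain ⟨g, hg, rfl⟩ := h
  obtain ⟨g', hg', rfl⟩ := h'
  exact ⟨g' * g, mul_mem hg' hg, rfl⟩

lemma commute_complementFactor (hcomm : ∀ i j, i ≠ j → ∀ x ∈ S i, ∀ y ∈ S j, x * y = y * x)
    {i : ι} {s c : Equiv.Perm X} (hs : s ∈ S i) (hc : c ∈ complementFactor S i) :
    s * c = c * s := by
  have hle : complementFactor S i ≤ Subgroup.centralizer (S i) :=
    iSup₂_le fun j hj y hy => Subgroup.mem_centralizer_iff.2 fun x hx => hcomm i j hj.symm x hx y hy
  exact Subgroup.mem_centralizer_iff.1 (hle hc) s hs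

lemma exists_mul_of_mem_iSup (hcomm : ∀ i j, i ≠ j → ∀ x ∈ S i, ∀ y ∈ S j, x * y = y * x)
    (i : ι) {g : Equiv.Perm X} (hg : g ∈ ⨆ j, S j) :
    ∃ c ∈ complementFactor S i, ∃ s ∈ S i, g = c * s := by
  classical
  refine Subgroup.iSup_induction S (C := fun g => ∃ c ∈ complementFactor S i, ∃ s ∈ S i, g = c * s)
    hg (fun j x hx => ?_) ⟨1, one_mem _, 1, one_mem _, by simp⟩ ?_
  · rcases eq_or_ne j i with rfl | hj
    · exact ⟨1, one_mem _, x, hx, by simp⟩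
    · exact ⟨x, le_complementFactor hj hx, 1, one_mem _, by simp⟩
  · rintro _ _ ⟨c, hc, s, hs, rfl⟩ ⟨c', hc', s', hs', rfl⟩
    refine ⟨c * c', mul_mem hc hc', s * s', mul_mem hs hs', ?_⟩
    rw [mul_assoc, ← mul_assoc s, commute_complementFactor hcomm hs hc']
    simp only [mul_assoc]

/-- Coordinates can be prescribed independently. A point with the right coordinates in a finite
set of indices is corrected in one more coordinate by the factor of that index, which does not
affect the others. -/
lemma exists_forall_sameCoord [Finite ι] [Nonempty X]
    (hcomm : ∀ i j, i ≠ j → ∀ x ∈ S i, ∀ y ∈ S j, x * y = y * x)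
    (htrans : ∀ x y : X, ∃ g ∈ ⨆ i, S i, g x = y) (F : ι → X) :
    ∃ y, ∀ i, SameCoord S i y (F i) := by
  classical
  have := Fintype.ofFinite ι
  suffices H : ∀ s : Finset ι, ∃ y, ∀ i ∈ s, SameCoord S i y (F i) by
    obtain ⟨y, hy⟩ := H Finset.univ
    exact ⟨y, fun i => hy i (Finset.mem_univ i)⟩
  intro s
  induction s using Finset.induction_on with
  | empty => exact ⟨Classical.arbitrary X, by simp⟩
  | insert k s _ ih =>
    obtain ⟨y, hy⟩ := ih
    obtain ⟨g, hg, hgy⟩ := htrans y (F k)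
    obtain ⟨c, hc, t, ht, rfl⟩ := exists_mul_of_mem_iSup hcomm k hg
    refine ⟨t y, fun i hi => ?_⟩
    rcases eq_or_ne i k with rfl | hik
    · exact ⟨c, hc, hgy⟩
    · have hty : SameCoord S i y (t y) := ⟨t, le_complementFactor hik.symm ht, rfl⟩
      exact hty.symm.trans (hy i (Finset.mem_of_mem_insert_of_ne hi hik))

/-- A permutation that normalizes the set of factors permutes the coordinates. -/
lemma sameCoord_apply_iff {g : Equiv.Perm X} {σ : ι → ι} (hσ : Function.Bijective σ)
    (hg : ∀ i, (S i).map (MulAut.conj g).toMonoidHom = S (σ i)) (i : ι) (x y : X) :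
    SameCoord S i x y ↔ SameCoord S (σ i) (g x) (g y) := by
  have hC : (complementFactor S i).map (MulAut.conj g).toMonoidHom = complementFactor S (σ i) := by
    simp only [complementFactor, Subgroup.map_iSup, hg]
    refine le_antisymm (iSup₂_le fun j hj => le_complementFactor (hσ.1.ne hj))
      (iSup₂_le fun k hk => ?_)
    obtain ⟨j, rfl⟩ := hσ.2 k
    exact le_iSup₂_of_le (f := fun j (_ : j ≠ i) => S (σ j)) j (fun h => hk (h ▸ rfl)) le_rfl
  constructor
  · rintro ⟨c, hc, rfl⟩
    exact ⟨_, hC.le (Subgroup.mem_map_of_mem _ hc), by simp⟩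
  · rintro ⟨c', hc', h⟩
    obtain ⟨c, hc, rfl⟩ := hC.ge hc'
    exact ⟨c, hc, g.injective (by simpa using h)⟩

/-- If the prime `p` does not divide the number of points, then `s` has a fixed point, and every
point is the image of this one under an element that commutes with `s`. -/
lemma eq_one_of_commute_of_transitive [Finite X] {p : ℕ} [Fact p.Prime] (hp : ¬ p ∣ Nat.card X)
    {C : Subgroup (Equiv.Perm X)} (hC : ∀ x y : X, ∃ c ∈ C, c x = y) {s : Equiv.Perm X}
    (hs : ∀ c ∈ C, s * c = c * s) (hsp : s ^ p = 1) : s = 1 := by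
  have := Fintype.ofFinite X
  rw [Nat.card_eq_fintype_card] at hp
  obtain ⟨a, ha⟩ := Equiv.Perm.exists_fixed_point_of_prime (n := 1) hp (σ := s) (by simpa using hsp)
  ext1 x
  obtain ⟨c, hc, rfl⟩ := hC a x
  have := congrArg (fun f : Equiv.Perm X => f a) (hs c hc)
  simpa [ha] using this

end ProductAction

/-- What is needed of the coordinates of the set underlying a wreath product: equivalence
relations `E i` ("equal `i`-th coordinate") that can be prescribed independently, none of which
holds everywhere, and which the group permutes. -/
structure IsPermutedCoordinates {X : Type*} {ι : Type*} (G : Set (Equiv.Perm X))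
    (E : ι → X → X → Prop) : Prop where
  equivalence : ∀ i, Equivalence (E i)
  exists_forall : ∀ F : ι → X, ∃ y, ∀ i, E i y (F i)
  exists_not : ∀ i, ∃ x y, ¬ E i x y
  exists_apply : ∀ g ∈ G, ∀ i, ∃ j, ∀ x y, E i x y ↔ E j (g x) (g y)

lemma three_dvd_card_of_four_le_degree {S : Type*} [Group S] {e : ℕ} (he : 2 ≤ e)
    (hS : Nonempty (S ≃* alternatingGroup (Fin (2 ^ e))) ∨
      Nonempty (S ≃* Equiv.Perm (Fin (2 ^ e)))) : 3 ∣ Nat.card S := by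
  have h4 : 4 ≤ 2 ^ e := (by norm_num : 4 = 2 ^ 2).trans_le (Nat.pow_le_pow_right two_pos he)
  have h3 : 3 ∣ (2 ^ e).factorial := Nat.dvd_factorial (by norm_num) (by omega)
  have : Nontrivial (Fin (2 ^ e)) := Fin.nontrivial_iff_two_le.2 (by omega)
  rcases hS with ⟨⟨φ⟩⟩ | ⟨⟨φ⟩⟩
  · rw [Nat.card_congr φ.toEquiv]
    have h2 := two_mul_nat_card_alternatingGroup (α := Fin (2 ^ e))
    rw [Nat.card_perm, Nat.card_fin] at h2
    rw [← h2] at h3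
    exact (by norm_num : Nat.Coprime 3 2).dvd_of_dvd_mul_left h3
  · rwa [Nat.card_congr φ.toEquiv, Nat.card_perm, Nat.card_fin]

lemma card_le_two_of_degree_two {S : Type*} [Group S]
    (hS : Nonempty (S ≃* alternatingGroup (Fin (2 ^ 1))) ∨
      Nonempty (S ≃* Equiv.Perm (Fin (2 ^ 1)))) : Nat.card S ≤ 2 := by
  have hP : Nat.card (Equiv.Perm (Fin (2 ^ 1))) = 2 := by
    rw [Nat.card_perm, Nat.card_fin]; rfl
  rcases hS with ⟨⟨φ⟩⟩ | ⟨⟨φ⟩⟩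
  · rw [Nat.card_congr φ.toEquiv]
    exact (Subgroup.card_le_card_group (alternatingGroup (Fin (2 ^ 1)))).trans hP.le
  · rw [Nat.card_congr φ.toEquiv, hP]

/-- In a wreath product, the orbits of the products of all but one of the factors are the
classes of a system of coordinates. -/
lemma IsWreathProduct.exists_coordinates {X : Type*} [Finite X] [Nontrivial X]
    {G : Subgroup (Equiv.Perm X)} (hG : IsWreathProduct G) :
    ∃ (c : ℕ) (E : Fin c → X → X → Prop), 1 < c ∧ IsPermutedCoordinates (G : Set _) E := by
  obtain ⟨c, e, S, T, M, hc, hX, hcomm, hind, hS, hT, -, hreg, -, -, -, -, -, -, hconj, -⟩ := hG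
  have hTS : (⨆ i, T i) ≤ ⨆ i, S i := iSup_mono fun i => (hT i).1
  have he : e ≠ 0 := by
    rintro rfl
    have := Finite.one_lt_card (α := X)
    simp [hX] at this
  have hSbot : ∀ i, S i ≠ ⊥ := by
    intro i hi
    have h1 := (hT i).2.2
    rw [eq_bot_iff.2 ((hT i).1.trans hi.le), Subgroup.card_bot] at h1
    exact (Nat.one_lt_two_pow he).ne h1
  have hinj : Function.Injective S := hind.injective hSbot
  have htrans : ∀ x y : X, ∃ g ∈ ⨆ i, S i, g x = y := fun x y => by
    obtain ⟨t, ⟨ht, hxy⟩, -⟩ := hreg x y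
    exact ⟨t, hTS ht, hxy⟩
  refine ⟨c, SameCoord S, hc, ⟨fun i => ⟨.refl i, .symm, .trans⟩,
    exists_forall_sameCoord hcomm htrans, fun i => ?_, fun g hg i => ?_⟩⟩
  · -- the product of the other factors is not transitive, as `S i` commutes with it
    by_contra! hall
    have hall' : ∀ x y : X, ∃ g ∈ complementFactor S i, g x = y := hall
    rcases (by omega : e = 1 ∨ 2 ≤ e) with rfl | he2
    · -- here `S j = T j` for all `j`, and a regular group has no transitive proper subgroup
      have hST : ∀ j, T j = S j := fun j =>
        Subgroup.eq_of_le_of_card_ge (hT j).1 ((card_le_two_of_degree_two (hS j)).trans (hT j).2.2.ge)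
      obtain ⟨⟨s, hs⟩, hs1⟩ := (S i).ne_bot_iff_exists_ne_one.1 (hSbot i)
      obtain ⟨x⟩ := (inferInstance : Nonempty X)
      obtain ⟨c, hc, hcx⟩ := hall' x (s x)
      have hcT : c ∈ ⨆ j, T j :=
        (iSup₂_le fun j _ => (hST j).ge.trans (le_iSup T j) : complementFactor S i ≤ _) hc
      have hsc : s = c := (hreg x (s x)).unique
        ⟨le_iSup T i ((hST i).ge hs), rfl⟩ ⟨hcT, hcx⟩
      have := Subgroup.disjoint_def.1 (hind i) hs (hsc ▸ hc)
      exact hs1 (Subtype.ext this)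
    · obtain ⟨s, hs⟩ := exists_prime_orderOf_dvd_card' 3 (three_dvd_card_of_four_le_degree he2 (hS i))
      have h3 : ¬ 3 ∣ Nat.card X := by
        rw [hX]
        exact fun h => absurd (Nat.prime_three.dvd_of_dvd_pow h) (by norm_num)
      have hs1 := eq_one_of_commute_of_transitive h3 hall'
        (fun c hc => commute_complementFactor hcomm s.2 hc)
        (by rw [← Subgroup.coe_pow, ← hs, pow_orderOf_eq_one, Subgroup.coe_one])
      rw [show s = 1 from Subtype.ext hs1, orderOf_one] at hs
      norm_num at hs
  · choose σ hσ using hconj g hg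
    have hσi : Function.Injective σ := fun j k hjk => hinj <|
      Subgroup.map_injective (MulAut.conj g).injective ((hσ j).trans (hjk ▸ (hσ k).symm))
    exact ⟨σ i, sameCoord_apply_iff (Finite.injective_iff_bijective.1 hσi) hσ i⟩

/-! ### Translations preserve every coordinate -/

section Translations

variable {V ι : Type*} {G : Set (Equiv.Perm V)} {E : ι → V → V → Prop}

lemma IsPermutedCoordinates.exists_and_not (hE : IsPermutedCoordinates G E) {i j : ι}
    (hij : i ≠ j) : ∃ x y, E i x y ∧ ¬ E j x y := by
  classical
  obtain ⟨u, v, huv⟩ := hE.exists_not j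
  obtain ⟨x, hx⟩ := hE.exists_forall fun _ => u
  obtain ⟨y, hy⟩ := hE.exists_forall fun k => if k = i then u else v
  refine ⟨x, y, ?_, fun h => huv ?_⟩
  · have := hy i
    rw [if_pos rfl] at this
    exact (hE.equivalence i).trans (hx i) ((hE.equivalence i).symm this)
  · have := hy j
    rw [if_neg hij.symm] at this
    have e := hE.equivalence j
    exact e.trans (e.symm (hx j)) (e.trans h this)

lemma IsPermutedCoordinates.eq_of_imp (hE : IsPermutedCoordinates G E) {i j : ι}
    (h : ∀ x y, E i x y → E j x y) : i = j := by
  by_contra hij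
  obtain ⟨x, y, hx, hy⟩ := hE.exists_and_not hij
  exact hy (h x y hx)

variable [AddCommGroup V] [Module (ZMod 2) V] [LinearOrder ι]

/-- If the translations permute a system of coordinates, they preserve each coordinate. Suppose
that the translation by `v` moves the `i`-th coordinate. By commutativity it moves every
coordinate in the orbit `J` of `i` under all translations, and swaps them in pairs. Hence some
point `y` agrees with `y + v` in all coordinates of `J`: prescribe one coordinate in each pair at
will, and the other accordingly. Translating, every point `z` agrees with `z + v` in the `i`-th
coordinate, so the translation by `v` preserves this coordinate. -/
lemma IsPermutedCoordinates.add_right_iff (hE : IsPermutedCoordinates G E)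
    (hG : ∀ v : V, Equiv.addRight v ∈ G) (v : V) (i : ι) (x y : V) :
    E i x y ↔ E i (x + v) (y + v) := by
  have hadd : ∀ a b : V, a + b + b = a := fun a b => by
    rw [add_assoc, ZModModule.add_self, add_zero]
  choose σ hσ using fun v => hE.exists_apply _ (hG v)
  replace hσ : ∀ v i x y, E i x y ↔ E (σ v i) (x + v) (y + v) := hσ
  have hσσ : ∀ v i, σ v (σ v i) = i := fun v i => (hE.eq_of_imp fun x y hxy => by
    have := (hσ v _ _ _).1 ((hσ v i x y).1 hxy)
    rwa [hadd, hadd] at this).symm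
  have hcomm : ∀ v w i, σ v (σ w i) = σ w (σ v i) := fun v w i => hE.eq_of_imp fun x y hxy => by
    have := (hσ w _ _ _).1 ((hσ v _ _ _).1 hxy)
    rw [hσσ, hσσ] at this
    rwa [hσ w, hσσ, hσ v, hσσ, add_right_comm x, add_right_comm y]
  suffices h : σ v i = i by
    have := hσ v i x y
    rwa [h] at this
  by_contra hi
  have hmove : ∀ w, σ v (σ w i) ≠ σ w i := fun w h => hi (by
    rw [hcomm] at h
    rw [← hσσ w (σ v i), h, hσσ])
  obtain ⟨y, hy⟩ := hE.exists_forall fun j => if j < σ v j then 0 else v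
  have hfix : ∀ w, E (σ w i) (y + v) y := by
    intro w
    have h1 := (hσ v _ _ _).1 (hy (σ v (σ w i)))
    have h2 := hy (σ w i)
    rw [hσσ] at h1
    refine (hE.equivalence _).trans h1 ((hE.equivalence _).symm ?_)
    rcases lt_or_gt_of_ne (hmove w) with hlt | hlt
    · rw [if_neg hlt.not_gt] at h2
      rwa [if_pos hlt, zero_add]
    · rw [if_pos hlt] at h2
      rwa [if_neg hlt.not_gt, ZModModule.add_self]
  have hall : ∀ z, E i (z + v) z := by
    intro z
    have := (hσ (y + z) _ _ _).1 (hfix (y + z))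
    rwa [hσσ, add_right_comm, ← add_assoc, ZModModule.add_self, zero_add] at this
  obtain ⟨a, b, hab, hnot⟩ := hE.exists_and_not hi
  have := (hσ v _ _ _).1 hab
  rw [hσσ] at this
  have e := hE.equivalence i
  exact hnot (e.trans (e.symm (hall a)) (e.trans this (hall b)))

/-- The class of `0` for the `i`-th coordinate. It is a subspace because translations preserve the
coordinate, and the other classes are its cosets. -/
def coordKernel (hE : IsPermutedCoordinates G E) (hG : ∀ v : V, Equiv.addRight v ∈ G) (i : ι) :
    Submodule (ZMod 2) V :=
  AddSubgroup.toZModSubmodule 2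
    { carrier := {x | E i x 0}
      zero_mem' := (hE.equivalence i).refl 0
      add_mem' := fun {x y} hx hy => by
        have := (hE.add_right_iff hG y i x 0).1 hx
        rw [zero_add] at this
        exact (hE.equivalence i).trans this hy
      neg_mem' := fun {x} hx => by rwa [ZModModule.neg_eq_self] }

lemma add_mem_coordKernel (hE : IsPermutedCoordinates G E) (hG : ∀ v : V, Equiv.addRight v ∈ G)
    (i : ι) (x y : V) : x + y ∈ coordKernel hE hG i ↔ E i x y := by
  have := hE.add_right_iff hG y i x y
  rw [ZModModule.add_self] at this
  exact this.symm

lemma coordKernel_ne_top (hE : IsPermutedCoordinates G E) (hG : ∀ v : V, Equiv.addRight v ∈ G)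
    (i : ι) : coordKernel hE hG i ≠ ⊤ := by
  intro h
  obtain ⟨x, y, hxy⟩ := hE.exists_not i
  exact hxy ((add_mem_coordKernel hE hG i x y).1 (h ▸ Submodule.mem_top))

lemma coordKernel_ne_bot [Nontrivial ι] (hE : IsPermutedCoordinates G E)
    (hG : ∀ v : V, Equiv.addRight v ∈ G) (i : ι) : coordKernel hE hG i ≠ ⊥ := by
  intro h
  obtain ⟨j, hj⟩ := exists_ne i
  obtain ⟨x, y, hxy, hne⟩ := hE.exists_and_not hj.symm
  rw [← add_mem_coordKernel hE hG, h, Submodule.mem_bot, ← ZModModule.sub_eq_add,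
    sub_eq_zero] at hxy
  exact hne (hxy ▸ (hE.equivalence j).refl x)

end Translations

/-! ### The group of a round -/

section Round

variable {m n l : ℕ} {K : Type*} {C : TBCipher m n l K} {h : Fin l}

/-- The key with round key `0` yields `γ_h λ_h` itself. -/
lemma TBCipher.trans_mem_roundGroup
    (hφ : Function.Surjective fun k => C.keySchedule k h) :
    (bricklayer (C.brick h)).trans (C.mixing h).toEquiv ∈ C.roundGroup h := by
  obtain ⟨k, hk⟩ := hφ 0
  have : C.roundFunction k h = (bricklayer (C.brick h)).trans (C.mixing h).toEquiv := by
    ext1 x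
    simp only [roundFunction] at hk ⊢
    simp [hk]
  exact this ▸ Subgroup.subset_closure ⟨k, rfl⟩

lemma TBCipher.addRight_mem_roundGroup
    (hφ : Function.Surjective fun k => C.keySchedule k h) (v : Msg m n) :
    Equiv.addRight v ∈ C.roundGroup h := by
  obtain ⟨k, hk⟩ := hφ v
  have hk' : C.roundFunction k h ∈ C.roundGroup h := Subgroup.subset_closure ⟨k, rfl⟩
  have := mul_mem hk' (inv_mem (C.trans_mem_roundGroup hφ))
  convert this using 1
  rw [eq_mul_inv_iff_mul_eq]
  ext1 x
  simp only at hk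
  simp [roundFunction, hk]

lemma apply_add_apply_mem_iff {U : Submodule (ZMod 2) (Msg m n)} (x y : Msg m n) :
    C.mixing h x + C.mixing h y ∈ U ↔ x + y ∈ U.comap (C.mixing h).toLinearMap := by
  simp

theorem isPreprimitive_roundGroup [Nontrivial (Msg m n)] (hh : C.IsProperRound h)
    (hg : ∀ i, AbsorbsDerivatives (C.brick h i)) :
    MulAction.IsPreprimitive (C.roundGroup h) (Msg m n) := by
  have htr := fun v => C.addRight_mem_roundGroup hh.2 v
  have : MulAction.IsPretransitive (C.roundGroup h) (Msg m n) :=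
    ⟨fun x y => ⟨⟨_, htr (-x + y)⟩, by simp [Subgroup.smul_def]⟩⟩
  refine MulAction.IsPreprimitive.of_isTrivialBlock_base 0 fun {B} h0 hB => ?_
  rw [MulAction.isBlock_iff_smul_eq_of_mem] at hB
  have hBmem : ∀ g ∈ C.roundGroup h, ∀ a ∈ B, g a ∈ B → ∀ x, g x ∈ B ↔ x ∈ B := by
    intro g hg a ha hga x
    have := hB (g := ⟨g, hg⟩) ha hga
    have hx := Set.smul_mem_smul_set_iff (a := (⟨g, hg⟩ : C.roundGroup h)) (s := B) (x := x)
    rwa [this] at hx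
  have hadd : ∀ v ∈ B, ∀ x, x + v ∈ B ↔ x ∈ B := fun v hv x =>
    hBmem _ (htr v) 0 h0 (by simpa using hv) x
  let U : Submodule (ZMod 2) (Msg m n) := AddSubgroup.toZModSubmodule 2
    { carrier := B
      zero_mem' := h0
      add_mem' := fun {x y} hx hy => (hadd y hy x).2 hx
      neg_mem' := fun {x} hx => by rwa [ZModModule.neg_eq_self] }
  have hU : ∀ x, x ∈ U ↔ x ∈ B := fun _ => Iff.rfl
  have hUW : ∀ x y, x + y ∈ U ↔ bricklayer (C.brick h) x + bricklayer (C.brick h) y ∈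
      U.comap (C.mixing h).toLinearMap := by
    intro x y
    rw [← apply_add_apply_mem_iff, hU, hU]
    -- the element `z ↦ (z + y)γλ + yγλ` of the group fixes `0`, so it preserves the block `B`
    have := hBmem _ (mul_mem (htr (C.mixing h (bricklayer (C.brick h) y)))
      (mul_mem (C.trans_mem_roundGroup hh.2) (htr y))) 0 h0
      (by simpa [ZModModule.add_self] using h0) (x + y)
    simpa [add_assoc, ZModModule.add_self] using this.symm
  by_cases hbot : U = ⊥
  · refine Or.inl fun x hx y hy => ?_
    rw [← hU, hbot, Submodule.mem_bot] at hx hy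
    rw [hx, hy]
  by_cases htop : U = ⊤
  · refine Or.inr (Set.eq_univ_of_forall fun x => ?_)
    rw [← hU, htop]
    exact Submodule.mem_top
  obtain ⟨hwall, hWU⟩ := isWall_of_cosets (C.bricklayer_zero h) hg hUW hbot htop
  exact absurd (Submodule.map_le_iff_le_comap.2 hWU.ge) (hh.1 U hwall)

theorem not_isWreathProduct_roundGroup [Nontrivial (Msg m n)] (hh : C.IsStronglyProperRound h)
    (hg : ∀ i, AbsorbsDerivatives (C.brick h i)) : ¬ IsWreathProduct (C.roundGroup h) := by
  intro hW
  obtain ⟨c, E, hc, hE⟩ := hW.exists_coordinates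
  have : Nontrivial (Fin c) := Fin.nontrivial_iff_two_le.2 hc
  have hφ := hh.1.2
  have htr : ∀ v, Equiv.addRight v ∈ (C.roundGroup h : Set (Equiv.Perm (Msg m n))) :=
    fun v => C.addRight_mem_roundGroup hφ v
  have key : ∀ i, IsWall (coordKernel hE htr i) ∧ ∃ j,
      (coordKernel hE htr j).comap (C.mixing h).toLinearMap = coordKernel hE htr i := by
    intro i
    obtain ⟨j, hj⟩ := hE.exists_apply _ (C.trans_mem_roundGroup hφ) i
    have := isWall_of_cosets (C.bricklayer_zero h) hg (U := coordKernel hE htr i)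
      (W := (coordKernel hE htr j).comap (C.mixing h).toLinearMap) (fun x y => by
        rw [← apply_add_apply_mem_iff, add_mem_coordKernel, add_mem_coordKernel, hj]
        rfl) (coordKernel_ne_bot hE htr i) (coordKernel_ne_top hE htr i)
    exact ⟨this.1, j, this.2⟩
  obtain ⟨hwall, j, hj⟩ := key ⟨0, by omega⟩
  refine hh.2 _ _ hwall (key j).1 ?_
  rw [← hj]
  exact Submodule.map_comap_eq_of_surjective (C.mixing h).surjective _

end Round

end TBC

theorem proposition4p4 {m n l : ℕ} {K : Type*} (hm : 1 < m) (hn : 1 < n)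
    (C : TBC.TBCipher m n l K) (h : Fin l) (hh : C.IsStronglyProperRound h)
    (hyp :
      (∃ r : ℕ, 1 < r ∧ r < m ∧ ∀ i : Fin n,
        TBC.IsUniform (2 ^ r) (C.brick h i) ∧
        TBC.IsStronglyAntiInvariant (r - 1) (C.brick h i)) ∨
      (∃ r : ℕ, 1 ≤ r ∧ r < m ∧ ∀ i : Fin n,
        TBC.IsWeaklyUniform (2 ^ r) (C.brick h i) ∧
        TBC.IsStronglyAntiInvariant r (C.brick h i))) :
    MulAction.IsPreprimitive (C.roundGroup h) (TBC.Msg m n) ∧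
      ¬ TBC.IsWreathProduct (C.roundGroup h) := by
  have : Nonempty (Fin n) := ⟨⟨0, by omega⟩⟩
  have : Nonempty (Fin m) := ⟨⟨0, by omega⟩⟩
  have hg : ∀ i, TBC.AbsorbsDerivatives (C.brick h i) := fun i => by
    rcases hyp with ⟨r, hr, hrm, hb⟩ | ⟨r, -, -, hb⟩
    · exact (hb i).1.absorbsDerivatives hr hrm (hb i).2
    · exact (hb i).1.absorbsDerivatives (hb i).2
  exact ⟨TBC.isPreprimitive_roundGroup hh.1 hg, TBC.not_isWreathProduct_roundGroup hh hg⟩
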